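/- Let $I$ be a finite set and let $\Delta$ be a right-angled building of type $M=(m_{ij})_{i,j\in I}$ (that is, $m_{ij}\in\{2,\infty\}$ for all $i\neq j$), viewed as a chamber system. For each $i\in I$ let $X_i$ be a set and let $F_i\leq\operatorname{Sym}(X_i)$ be a permutation group (not necessarily transitive or of finite degree). Assume that $\Delta$ is semiregular with parameters $q_i=|X_i|\geq 2$, i.e. every $i$-panel has cardinality $q_i$, and fix a legal colouring $\lambda=(\lambda_i)_{i\in I}\colon\Delta\to\prod_{i\in I}X_i$: for every $i\in I$ and every $i$-panel $\mathcal P$, the restriction $\lambda_i|_{\mathcal P}\colon\mathcal P\to X_i$ is a bijection, and $\lambda_j|_{\mathcal P}$ is constant for every $j\neq i$. Let $\operatorname{Aut}(\Delta)$ be the group of type-preserving automorphisms of $\Delta$, and let $$U(\boldsymbol F)=\bigl\{g\in\operatorname{Aut}(\Delta) : \lambda_i|_{g\mathcal P}\circ g|_{\mathcal P}\circ(\lambda_i|_{\mathcal P})^{-1}\in F_i\text{ for every } i\in I \text{ and every } i\text{-panel } \mathcal P\bigr\}$$ be the universal group with local groups $\boldsymbol F=(F_i)_{i\in I}$. Every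 permutation group $G\leq\operatorname{Sym}(Y)$ (in particular $F_i\leq\operatorname{Sym}(X_i)$ and $U(\boldsymbol F)\leq\operatorname{Aut}(\Delta)\leq\operatorname{Sym}(\Delta)$) carries the permutation topology, in which the pointwise stabilisers of finite subsets of $Y$ form a neighbourhood basis of the identity. A topological group is called compactly generated if it is generated, as a group, by a compact subset. Suppose that $U(\boldsymbol F)$ is closed in $\operatorname{Aut}(\Delta)$ and locally compact, and that for each $i\in I$ the group $F_i$ is compactly generated and has finitely many orbits on $X_i$. Then $U(\boldsymbol F)$ is compactly generated. -/

import Mathlib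

/-! ### Permutation groups as topological groups -/

/-- The permutation topology on `Sym(X)`: a set `U` is open iff around each of its points `g` it
contains a coset `g · Sym(X)_{(Φ)}` of the pointwise stabiliser of a finite set `Φ ⊆ X`. Permutation
groups `G ≤ Sym(X)` carry the subspace topology. -/
instance permTopology (X : Type*) : TopologicalSpace (Equiv.Perm X) where
  IsOpen U := ∀ g ∈ U, ∃ Φ : Finset X,
    ∀ s ∈ fixingSubgroup (Equiv.Perm X) (Φ : Set X), g * s ∈ U
  isOpen_univ := fun _ _ => ⟨∅, fun _ _ => trivial⟩
  isOpen_inter := by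
    classical
    intro U V hU hV g hg
    obtain ⟨Φ, hΦ⟩ := hU g hg.1
    obtain ⟨Ψ, hΨ⟩ := hV g hg.2
    refine ⟨Φ ∪ Ψ, fun s hs => ⟨hΦ s ?_, hΨ s ?_⟩⟩
    · exact fixingSubgroup_antitone _ _ (by simp) hs
    · exact fixingSubgroup_antitone _ _ (by simp) hs
  isOpen_sUnion := by
    intro S hS g hg
    obtain ⟨U, hU, hgU⟩ := hg
    obtain ⟨Φ, hΦ⟩ := hS U hU g hgU
    exact ⟨Φ, fun s hs => ⟨U, hU, hΦ s hs⟩⟩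

/-- A topological group is compactly generated if some compact subset generates it
(algebraically) as a group. -/
def IsCompactlyGeneratedGroup (G : Type*) [Group G] [TopologicalSpace G] : Prop :=
  ∃ S : Set G, IsCompact S ∧ Subgroup.closure S = ⊤

/-! ### Chamber systems and right-angled buildings -/

/-- A chamber system over the index set `I` with set of chambers `Δ`: an equivalence relation on
`Δ` (`i`-adjacency) for each `i ∈ I`. -/
structure ChamberSystem (I : Type*) (Δ : Type*) where
  adj : I → Setoid Δ

namespace ChamberSystem

variable {I Δ : Type*}

/-- The `i`-panels (that is, the residues of type `{i}`): the classes of `i`-adjacency. -/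
def panels (C : ChamberSystem I Δ) (i : I) : Set (Set Δ) := (C.adj i).classes

/-- `C.IsGallery c ω d`: there is a gallery of type `ω` from `c` to `d`. Consecutive chambers of a
gallery are distinct. -/
inductive IsGallery (C : ChamberSystem I Δ) : Δ → List I → Δ → Prop
  | nil (c : Δ) : IsGallery C c [] c
  | cons {c d e : Δ} {i : I} {ω : List I} :
      (C.adj i) c d → c ≠ d → IsGallery C d ω e → IsGallery C c (i :: ω) e

/-- A chamber system is a building of type `M` if it has a chamber, each panel contains at least
two chambers, and there is a Weyl distance `δ : Δ × Δ → W` to the Coxeter group `W` of type `M`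
such that, for every reduced word `ω`, `δ(c, d)` is the element represented by `ω` iff `c` and `d`
are joined by a gallery of type `ω`. -/
structure IsBuilding (C : ChamberSystem I Δ) (M : CoxeterMatrix I) : Prop where
  nonempty : Nonempty Δ
  panel_nontrivial : ∀ i, ∀ P ∈ C.panels i, P.Nontrivial
  exists_dist : ∃ δ : Δ → Δ → M.Group, ∀ ω : List I, M.toCoxeterSystem.IsReduced ω →
    ∀ c d : Δ, δ c d = M.toCoxeterSystem.wordProd ω ↔ C.IsGallery c ω d

/-- The group `Aut(Δ)` of (type-preserving) automorphisms: the permutations of the chambers that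
preserve `i`-adjacency for each `i`. -/
def aut (C : ChamberSystem I Δ) : Subgroup (Equiv.Perm Δ) where
  carrier := {g | ∀ i c d, (C.adj i) (g c) (g d) ↔ (C.adj i) c d}
  one_mem' := fun _ _ _ => Iff.rfl
  mul_mem' := fun {g h} hg hh i c d => (hg i (h c) (h d)).trans (hh i c d)
  inv_mem' := fun {g} hg i c d => by
    simpa using (hg i (g⁻¹ c) (g⁻¹ d)).symm

/-- An automorphism maps `i`-panels to `i`-panels. -/
theorem image_mem_panels (C : ChamberSystem I Δ) (g : C.aut) {i : I} {P : Set Δ}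
    (hP : P ∈ C.panels i) : (g : Equiv.Perm Δ) '' P ∈ C.panels i := by
  obtain ⟨c, rfl⟩ := hP
  refine ⟨(g : Equiv.Perm Δ) c, ?_⟩
  ext d
  constructor
  · rintro ⟨e, he, rfl⟩
    exact (g.2 i e c).2 he
  · intro hd
    refine ⟨(g : Equiv.Perm Δ).symm d, ?_, by simp⟩
    refine (g.2 i _ c).1 ?_
    simpa using hd

end ChamberSystem

/-- A Coxeter matrix is right-angled if `m_{ij} ∈ {2, ∞}` for all distinct `i`, `j`
(Mathlib encodes `m_{ij} = ∞` as `M i j = 0`). -/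
def CoxeterMatrix.IsRightAngled {I : Type*} (M : CoxeterMatrix I) : Prop :=
  ∀ i j, i ≠ j → M i j = 2 ∨ M i j = 0

/-! ### Legal colourings, local actions and universal groups -/

/-- A legal colouring `λ` of a chamber system with colour sets `X i`: on each `i`-panel the
`i`-colour is a bijection to `X i` and each other colour is constant. -/
structure LegalColouring {I Δ : Type*} (C : ChamberSystem I Δ) (X : I → Type*) where
  colour : Δ → ∀ i, X i
  bijective : ∀ i, ∀ P ∈ C.panels i, Function.Bijective fun c : P => colour c i
  constant : ∀ i, ∀ P ∈ C.panels i, ∀ j, j ≠ i → ∀ c ∈ P, ∀ d ∈ P, colour c j = colour d j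

namespace LegalColouring

variable {I Δ : Type*} {C : ChamberSystem I Δ} {X : I → Type*}

/-- The bijection `λ_i|_P : P → X i` for an `i`-panel `P`. -/
noncomputable def panelEquiv (l : LegalColouring C X) {i : I} {P : Set Δ} (hP : P ∈ C.panels i) :
    P ≃ X i :=
  Equiv.ofBijective (fun c : P => l.colour c i) (l.bijective i P hP)

/-- The local action `σ(g, P) = λ_i|_{gP} ∘ g|_P ∘ (λ_i|_P)⁻¹ ∈ Sym(X i)` of an automorphism `g`
at an `i`-panel `P`. -/
noncomputable def localAction (l : LegalColouring C X) (g : C.aut) {i : I} {P : Set Δ}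
    (hP : P ∈ C.panels i) : Equiv.Perm (X i) :=
  (l.panelEquiv hP).symm.trans
    (((g : Equiv.Perm Δ).image P).trans (l.panelEquiv (C.image_mem_panels g hP)))

theorem localAction_colour (l : LegalColouring C X) (g : C.aut) {i : I} {P : Set Δ}
    (hP : P ∈ C.panels i) {c : Δ} (hc : c ∈ P) :
    l.localAction g hP (l.colour c i) = l.colour ((g : Equiv.Perm Δ) c) i := by
  have h : (l.panelEquiv hP).symm (l.colour c i) = ⟨c, hc⟩ := by
    rw [Equiv.symm_apply_eq]; rfl
  simp only [localAction, Equiv.trans_apply, h]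
  rfl

theorem localAction_eq (l : LegalColouring C X) (g : C.aut) {i : I} {P : Set Δ}
    (hP : P ∈ C.panels i) {f : Equiv.Perm (X i)}
    (h : ∀ c ∈ P, f (l.colour c i) = l.colour ((g : Equiv.Perm Δ) c) i) :
    l.localAction g hP = f := by
  ext x
  obtain ⟨⟨c, hc⟩, rfl⟩ := (l.bijective i P hP).2 x
  exact (l.localAction_colour g hP hc).trans (h c hc).symm

/-- The universal group `U(F) ≤ Aut(Δ)` of the local groups `F i ≤ Sym(X i)`: the automorphisms all
of whose local actions at `i`-panels belong to `F i`. -/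
def universalGroup (l : LegalColouring C X) (F : ∀ i, Subgroup (Equiv.Perm (X i))) :
    Subgroup C.aut where
  carrier := {g | ∀ i, ∀ P : Set Δ, ∀ hP : P ∈ C.panels i, l.localAction g hP ∈ F i}
  one_mem' := fun i P hP => by
    rw [l.localAction_eq 1 hP (f := 1) (fun _ _ => rfl)]
    exact (F i).one_mem
  mul_mem' := fun {g h} hg hh i P hP => by
    rw [l.localAction_eq (g * h) hP
      (f := l.localAction g (C.image_mem_panels h hP) * l.localAction h hP) (fun c hc => by
        rw [Equiv.Perm.mul_apply, l.localAction_colour h hP hc,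
          l.localAction_colour g _ (Set.mem_image_of_mem _ hc)]
        rfl)]
    exact (F i).mul_mem (hg i _ _) (hh i _ _)
  inv_mem' := fun {g} hg i P hP => by
    rw [l.localAction_eq g⁻¹ hP (f := (l.localAction g (C.image_mem_panels g⁻¹ hP))⁻¹)
      (fun c hc => by
        rw [Equiv.Perm.inv_eq_iff_eq,
          l.localAction_colour g _ (Set.mem_image_of_mem _ hc)]
        simp)]
    exact (F i).inv_mem (hg i _ _)

end LegalColouring

/-!
Write `U` for the universal group, which acts on the chambers with finitely many orbits since
chambers whose colours have the same orbits are conjugate. Local compactness gives a finite set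
`Φ` of chambers with compact fixator `U_Φ`, so it suffices to generate `U` by `U_Φ` and finitely
many elements.

Every panel carries a splitting `F i → U`: the chambers are partitioned into wings according to
their projections onto the panel, and `f` permutes the wings as it permutes the panel, changing
the `i`-colours in each wing by a single element of `F i`. It fixes a wing pointwise when it fixes
its colour. As `F i` is compactly generated, it is finitely generated over the fixator of the
finitely many colours of the wings that meet `Φ`; hence its image in `U` is finitely generated
over `U_Φ`. Such images connect fixators of finite sets: if `g` fixes `Ψ ∋ c` and `d` is in the
`i`-panel of `c`, then `g` differs by an element of the image from an element that also fixes `d`.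
Hence chamber stabilisers are finitely generated over `U_Φ`. By connectedness, `U` is generated by
the stabilisers and panel groups of finitely many chambers, with finitely many elements more.

All of this rests on the extension principle that two legally coloured right-angled buildings of
the same type are isomorphic by a map that preserves the colours and sends a given chamber to any
given chamber of the same colours: a chamber is reached by following the colours along a gallery,
and which coloured words lead to the same chamber depends on the Coxeter matrix alone.
-/

/-! ### Reduced words and descents -/

namespace CoxeterWord

variable {I : Type*} {M : CoxeterMatrix I} {W : Type*} [Group W] (cs : CoxeterSystem M W)

open CoxeterSystem hiding IsReduced

local prefix:100 "s" => cs.simple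
local prefix:100 "π" => cs.wordProd
local prefix:100 "ℓ" => cs.length

section Descents

variable {cs}

theorem isReduced_cons_iff {i : I} {ω : List I} :
    cs.IsReduced (i :: ω) ↔ cs.IsReduced ω ∧ ¬cs.IsLeftDescent (π ω) i := by
  have key (hω : cs.IsReduced ω) : cs.IsReduced (i :: ω) ↔ ¬cs.IsLeftDescent (π ω) i := by
    rw [cs.not_isLeftDescent_iff, CoxeterSystem.IsReduced, wordProd_cons, hω.eq, List.length_cons]
  exact ⟨fun h => ⟨h.drop 1, (key (h.drop 1)).1 h⟩, fun h => (key h.1).2 h.2⟩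

theorem isReduced_append_singleton_iff {i : I} {ω : List I} :
    cs.IsReduced (ω ++ [i]) ↔ cs.IsReduced ω ∧ ¬cs.IsRightDescent (π ω) i := by
  rw [← cs.isReduced_reverse_iff, List.reverse_append, List.reverse_singleton,
    List.singleton_append, isReduced_cons_iff, cs.isReduced_reverse_iff, wordProd_reverse,
    cs.isLeftDescent_inv_iff]

variable (cs) in
theorem exists_isReduced_cons {w : W} {i : I} (h : cs.IsLeftDescent w i) :
    ∃ ω, cs.IsReduced (i :: ω) ∧ w = π (i :: ω) := by
  obtain ⟨ω, hω, hprod⟩ := cs.exists_isReduced (s i * w)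
  refine ⟨ω, isReduced_cons_iff.2 ⟨hω, ?_⟩, ?_⟩
  · rwa [← hprod, ← cs.isLeftDescent_iff_not_isLeftDescent_mul]
  · rw [wordProd_cons, ← hprod, simple_mul_simple_cancel_left]

variable (cs) in
theorem exists_isReduced_append_singleton {w : W} {i : I} (h : cs.IsRightDescent w i) :
    ∃ ω, cs.IsReduced (ω ++ [i]) ∧ w = π (ω ++ [i]) := by
  obtain ⟨ω, hω, hprod⟩ := cs.exists_isReduced (w * s i)
  refine ⟨ω, isReduced_append_singleton_iff.2 ⟨hω, ?_⟩, ?_⟩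
  · rwa [← hprod, ← cs.isRightDescent_iff_not_isRightDescent_mul]
  · rw [wordProd_append, wordProd_singleton, ← hprod, simple_mul_simple_cancel_right]

theorem not_isRightDescent_of_isLeftDescent_mul {w : W} {i j : I} (hw : ¬cs.IsLeftDescent w i)
    (hwj : cs.IsLeftDescent (w * s j) i) : ¬cs.IsRightDescent w j := by
  intro hj
  rw [cs.isRightDescent_iff] at hj
  rw [cs.isLeftDescent_iff, ← mul_assoc] at hwj
  rw [cs.not_isLeftDescent_iff] at hw
  rcases cs.length_mul_simple (s i * w) j with h | h <;> lia

end Descents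

section RightAngled

variable (M) in
/-- The letter `i` is exposed in a word if it has an occurrence that commutes with every letter
before it. -/
def Exposed (i : I) : List I → Prop
  | [] => False
  | j :: ω => j = i ∨ M i j = 2 ∧ Exposed i ω

theorem ne_of_eq_two {i j : I} (h : M i j = 2) : i ≠ j := by
  rintro rfl
  simp at h

theorem exposed_append_singleton {i k : I} {ω : List I} :
    Exposed M i (ω ++ [k]) ↔ Exposed M i ω ∨ i = k ∧ ∀ j ∈ ω, M i j = 2 := by
  induction ω with
  | nil => simp [Exposed, eq_comm]
  | cons j ω ih =>
    simp only [List.cons_append, Exposed, ih, List.mem_cons, forall_eq_or_imp]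
    tauto

include cs in
theorem simple_mul_simple_comm {i j : I} (h : M i j = 2) :
    cs.simple i * cs.simple j = cs.simple j * cs.simple i := by
  have hpow := cs.simple_mul_simple_pow i j
  rw [h, pow_two, mul_eq_one_iff_eq_inv] at hpow
  simpa using hpow

theorem Exposed.exists_wordProd_eq {i : I} {ω : List I} (h : Exposed M i ω) :
    ∃ η : List I, η.length + 1 = ω.length ∧ π η = s i * π ω := by
  induction ω with
  | nil => exact h.elim
  | cons j ω ih =>
    rcases h with rfl | ⟨hij, h⟩
    · exact ⟨ω, rfl, by simp [wordProd_cons]⟩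
    · obtain ⟨η, hlen, hη⟩ := ih h
      refine ⟨j :: η, by simp [← hlen], ?_⟩
      rw [wordProd_cons, wordProd_cons, hη, ← mul_assoc, ← mul_assoc,
        simple_mul_simple_comm cs hij]

theorem Exposed.isLeftDescent {i : I} {ω : List I} (h : Exposed M i ω) (hω : cs.IsReduced ω) :
    cs.IsLeftDescent (π ω) i := by
  obtain ⟨η, hlen, hη⟩ := h.exists_wordProd_eq cs
  have := cs.length_wordProd_le η
  rw [IsLeftDescent, ← hη, hω.eq]
  lia

section Representation

open scoped Classical in
variable (M) in
/-- The reflection attached to `i` in the contragredient of the geometric representation of a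
right-angled Coxeter group, written on functionals by their values `f j` at the simple roots. The
sign of `f j` detects the left descents of the group element that has been applied. -/
noncomputable def reflection (i : I) : Function.End (I → ℤ) := fun f j =>
  if j = i then -f i else if M i j = 0 then f j + 2 * f i else f j

theorem reflection_apply_self (i : I) (f : I → ℤ) : reflection M i f i = -f i := if_pos rfl

theorem reflection_apply_of_eq_two {i j : I} (h : M i j = 2) (f : I → ℤ) :
    reflection M i f j = f j := by
  simp [reflection, (ne_of_eq_two h).symm, h]

theorem reflection_apply_of_eq_zero {i j : I} (h : M i j = 0) (f : I → ℤ) :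
    reflection M i f j = f j + 2 * f i := by
  have hji : j ≠ i := by
    rintro rfl
    simp at h
  simp [reflection, hji, h]

theorem isLiftable_reflection (hM : M.IsRightAngled) : M.IsLiftable (reflection M) := by
  intro i j
  rcases eq_or_ne i j with rfl | hij
  · rw [M.diagonal, pow_one]
    funext f k
    change reflection M i (reflection M i f) k = f k
    by_cases hk : k = i <;> by_cases hik : M i k = 0 <;> simp [reflection, hk, hik]
  · rcases hM i j hij with h | h
    · have hji : M j i = 2 := M.symmetric j i ▸ h
      rw [h, pow_two]
      funext f k
      change reflection M i (reflection M j (reflection M i (reflection M j f))) k = f k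
      by_cases hki : k = i <;> by_cases hkj : k = j <;> by_cases hik : M i k = 0 <;>
        by_cases hjk : M j k = 0 <;> (simp [reflection, *, hij.symm]; try ring)
    · rw [h, pow_zero]

variable (M) in
/-- The functional `f` is negative exactly at the simple roots in `S`, and each negative value is
outweighed by the value at any simple root joined to it by an edge of infinite order. -/
structure HasSignPattern (f : I → ℤ) (S : Set I) : Prop where
  neg : ∀ i ∈ S, f i < 0
  pos : ∀ i ∉ S, 0 < f i
  add_pos : ∀ i ∈ S, ∀ j, M i j = 0 → 0 < f i + f j

theorem HasSignPattern.reflection (hM : M.IsRightAngled) {f : I → ℤ} {S : Set I}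
    (h : HasSignPattern M f S) {i : I} (hi : i ∉ S) :
    HasSignPattern M (reflection M i f) {j | i = j ∨ M j i = 2 ∧ j ∈ S} := by
  have hfi := h.pos i hi
  have hself := reflection_apply_self (M := M) i f
  have add_pos (j : I) (hij : M i j = 0) : 0 < f i + f j := by
    by_cases hj : j ∈ S
    · linarith [h.add_pos j hj i (M.symmetric j i ▸ hij)]
    · linarith [h.pos j hj]
  constructor
  · rintro j (rfl | ⟨hji, hj⟩)
    · lia
    · rw [reflection_apply_of_eq_two (M.symmetric j i ▸ hji)]
      exact h.neg j hj
  · intro j hj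
    simp only [Set.mem_ofPred_eq, not_or, not_and] at hj
    rcases hM i j hj.1 with hij | hij
    · rw [reflection_apply_of_eq_two hij]
      exact h.pos j (hj.2 (M.symmetric i j ▸ hij))
    · rw [reflection_apply_of_eq_zero hij]
      linarith [add_pos j hij]
  · rintro j (rfl | ⟨hji, hj⟩) k hjk
    · rw [hself, reflection_apply_of_eq_zero hjk]
      linarith [add_pos k hjk]
    · have hik : i ≠ k := by
        rintro rfl
        lia
      rw [reflection_apply_of_eq_two (M.symmetric j i ▸ hji)]
      rcases hM i k hik with hik | hik
      · rw [reflection_apply_of_eq_two hik]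
        exact h.add_pos j hj k hjk
      · rw [reflection_apply_of_eq_zero hik]
        linarith [h.add_pos j hj k hjk]

/-- The orbit of the functional taking the value `1` at every simple root. -/
noncomputable def signVector (hM : M.IsRightAngled) (w : W) : I → ℤ :=
  cs.lift ⟨reflection M, isLiftable_reflection hM⟩ w fun _ => 1

theorem signVector_one (hM : M.IsRightAngled) : signVector cs hM 1 = fun _ => 1 := by
  rw [signVector, map_one]
  rfl

theorem signVector_simple_mul (hM : M.IsRightAngled) (i : I) (w : W) :
    signVector cs hM (s i * w) = reflection M i (signVector cs hM w) := by
  rw [signVector, map_mul, cs.lift_apply_simple]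
  rfl

variable {cs}

theorem hasSignPattern_signVector (hM : M.IsRightAngled) {ω : List I} (hω : cs.IsReduced ω) :
    HasSignPattern M (signVector cs hM (π ω)) {i | Exposed M i ω} := by
  induction ω with
  | nil => constructor <;> simp [Exposed, signVector_one]
  | cons i ω ih =>
    rw [wordProd_cons, signVector_simple_mul]
    exact (ih (hω.drop 1)).reflection hM (fun hi =>
      (isReduced_cons_iff.1 hω).2 (Exposed.isLeftDescent cs hi (hω.drop 1)))

end Representation

variable {cs}

theorem isLeftDescent_iff_exposed (hM : M.IsRightAngled) {i : I} {ω : List I}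
    (hω : cs.IsReduced ω) : cs.IsLeftDescent (π ω) i ↔ Exposed M i ω := by
  refine ⟨fun h => ?_, fun h => h.isLeftDescent cs hω⟩
  obtain ⟨η, hη, hprod⟩ := exists_isReduced_cons cs h
  have hneg := (hasSignPattern_signVector hM hη).neg i (Or.inl rfl)
  rw [← hprod] at hneg
  by_contra hi
  exact hneg.not_gt ((hasSignPattern_signVector hM hω).pos i hi)

theorem isReduced_pair (hM : M.IsRightAngled) {i j : I} (hij : i ≠ j) : cs.IsReduced [i, j] := by
  have hj : cs.IsReduced [j] := by simp [CoxeterSystem.IsReduced]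
  rw [isReduced_cons_iff, isLeftDescent_iff_exposed hM hj]
  exact ⟨hj, by simp [Exposed, hij.symm]⟩

theorem forall_eq_two_of_isLeftDescent_mul (hM : M.IsRightAngled) {ω : List I} {i j : I}
    (hω : cs.IsReduced ω) (hi : ¬cs.IsLeftDescent (π ω) i)
    (hj : cs.IsLeftDescent (π ω * s j) i) : i = j ∧ ∀ k ∈ ω, M i k = 2 := by
  have hred : cs.IsReduced (ω ++ [j]) := isReduced_append_singleton_iff.2
    ⟨hω, not_isRightDescent_of_isLeftDescent_mul hi hj⟩
  rw [← wordProd_singleton, ← wordProd_append, isLeftDescent_iff_exposed hM hred,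
    exposed_append_singleton, ← isLeftDescent_iff_exposed hM hω] at hj
  exact hj.resolve_left hi

end RightAngled

end CoxeterWord
/-! ### Galleries, the Weyl distance and projections onto panels -/

namespace ChamberSystem

variable {I Δ : Type*} {C : ChamberSystem I Δ} {M : CoxeterMatrix I}

theorem isGallery_append {ω η : List I} {c e : Δ} :
    C.IsGallery c (ω ++ η) e ↔ ∃ d, C.IsGallery c ω d ∧ C.IsGallery d η e := by
  induction ω generalizing c with
  | nil =>
    refine ⟨fun h => ⟨c, .nil c, h⟩, ?_⟩
    rintro ⟨_, ⟨⟩, h⟩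
    exact h
  | cons i ω ih =>
    constructor
    · rintro (_ | ⟨hadj, hne, h⟩)
      obtain ⟨d, hd, hη⟩ := ih.1 h
      exact ⟨d, .cons hadj hne hd, hη⟩
    · rintro ⟨d, _ | ⟨hadj, hne, h⟩, hη⟩
      exact .cons hadj hne (ih.2 ⟨d, h, hη⟩)

theorem isGallery_singleton {i : I} {c d : Δ} :
    C.IsGallery c [i] d ↔ C.adj i c d ∧ c ≠ d := by
  constructor
  · rintro (_ | ⟨hadj, hne, ⟨⟩⟩)
    exact ⟨hadj, hne⟩
  · exact fun ⟨hadj, hne⟩ => .cons hadj hne (.nil d)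

theorem IsGallery.map {ω : List I} {c d : Δ} (h : C.IsGallery c ω d) (g : C.aut) :
    C.IsGallery (g.1 c) ω (g.1 d) := by
  induction h with
  | nil c => exact .nil _
  | cons hadj hne _ ih => exact .cons ((g.2 _ _ _).2 hadj) (g.1.injective.ne hne) ih

namespace IsBuilding

open CoxeterSystem hiding IsReduced
open CoxeterWord

local notation "cs" => CoxeterMatrix.toCoxeterSystem M

variable (hC : C.IsBuilding M)

/-- The Weyl distance of a building, chosen among those provided by `exists_dist`. -/
noncomputable def dist (c d : Δ) : M.Group := hC.exists_dist.choose c d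

theorem dist_eq_wordProd_iff {ω : List I} (hω : (cs).IsReduced ω) {c d : Δ} :
    hC.dist c d = (cs).wordProd ω ↔ C.IsGallery c ω d :=
  hC.exists_dist.choose_spec ω hω c d

theorem dist_self (c : Δ) : hC.dist c c = 1 :=
  (hC.dist_eq_wordProd_iff (ω := []) (by simp [CoxeterSystem.IsReduced])).2 (.nil c)

theorem dist_map (g : C.aut) (c d : Δ) : hC.dist (g.1 c) (g.1 d) = hC.dist c d := by
  obtain ⟨ω, hω, h⟩ := (cs).exists_isReduced (hC.dist c d)
  rw [h, hC.dist_eq_wordProd_iff hω]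
  exact ((hC.dist_eq_wordProd_iff hω).1 h).map g

include hC in
theorem exists_isGallery (c d : Δ) : ∃ ω, (cs).IsReduced ω ∧ C.IsGallery c ω d := by
  obtain ⟨ω, hω, h⟩ := (cs).exists_isReduced (hC.dist c d)
  exact ⟨ω, hω, (hC.dist_eq_wordProd_iff hω).1 h⟩

include hC in
theorem reflTransGen_adj (c d : Δ) : Relation.ReflTransGen (fun c d => ∃ i, C.adj i c d) c d := by
  obtain ⟨ω, -, h⟩ := hC.exists_isGallery c d
  induction h with
  | nil => exact .refl
  | cons hadj _ _ ih => exact .head ⟨_, hadj⟩ ih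

theorem dist_eq_simple_mul {i : I} {c c' d : Δ} (hadj : C.adj i c c') (hne : c ≠ c')
    (h : ¬(cs).IsLeftDescent (hC.dist c' d) i) :
    hC.dist c d = (cs).simple i * hC.dist c' d := by
  obtain ⟨ω, hω, hdist⟩ := (cs).exists_isReduced (hC.dist c' d)
  rw [hdist, ← wordProd_cons, hC.dist_eq_wordProd_iff (isReduced_cons_iff.2 ⟨hω, hdist ▸ h⟩)]
  exact .cons hadj hne ((hC.dist_eq_wordProd_iff hω).1 hdist)

theorem isLeftDescent_dist {i : I} {c c' d : Δ} (hadj : C.adj i c c') (hne : c ≠ c')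
    (h : ¬(cs).IsLeftDescent (hC.dist c' d) i) : (cs).IsLeftDescent (hC.dist c d) i := by
  rwa [hC.dist_eq_simple_mul hadj hne h, (cs).isLeftDescent_iff_not_isLeftDescent_mul,
    simple_mul_simple_cancel_left]

theorem dist_eq_or_eq_mul_simple {j : I} {d e : Δ} (hadj : C.adj j d e) (c : Δ) :
    hC.dist c e = hC.dist c d ∨ hC.dist c e = hC.dist c d * (cs).simple j := by
  rcases eq_or_ne d e with rfl | hne
  · exact .inl rfl
  by_cases hj : (cs).IsRightDescent (hC.dist c d) j
  · obtain ⟨ω, hω, hd⟩ := exists_isReduced_append_singleton cs hj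
    obtain ⟨d', hd', hgal⟩ := isGallery_append.1 ((hC.dist_eq_wordProd_iff hω).1 hd)
    have hd'd := isGallery_singleton.1 hgal
    rw [hd]
    rcases eq_or_ne d' e with rfl | hne'
    · right
      rw [wordProd_append, wordProd_singleton, simple_mul_simple_cancel_right,
        hC.dist_eq_wordProd_iff (isReduced_append_singleton_iff.1 hω).1]
      exact hd'
    · exact .inl <| (hC.dist_eq_wordProd_iff hω).2 <| isGallery_append.2
        ⟨d', hd', isGallery_singleton.2 ⟨(C.adj j).trans hd'd.1 hadj, hne'⟩⟩
  · obtain ⟨ω, hω, hd⟩ := (cs).exists_isReduced (hC.dist c d)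
    rw [hd, ← wordProd_singleton, ← wordProd_append,
      hC.dist_eq_wordProd_iff (isReduced_append_singleton_iff.2 ⟨hω, hd ▸ hj⟩)]
    exact .inr <| isGallery_append.2
      ⟨d, (hC.dist_eq_wordProd_iff hω).1 hd, isGallery_singleton.2 ⟨hadj, hne⟩⟩

include hC in
theorem exists_adj_not_isLeftDescent (i : I) (c d : Δ) :
    ∃ p, C.adj i c p ∧ ¬(cs).IsLeftDescent (hC.dist p d) i := by
  by_cases h : (cs).IsLeftDescent (hC.dist c d) i
  · obtain ⟨ω, hred, hd⟩ := exists_isReduced_cons cs h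
    rcases (hC.dist_eq_wordProd_iff hred).1 hd with _ | ⟨hadj, -, hgal⟩
    obtain ⟨hω, hi⟩ := isReduced_cons_iff.1 hred
    exact ⟨_, hadj, (hC.dist_eq_wordProd_iff hω).2 hgal ▸ hi⟩
  · exact ⟨c, (C.adj i).refl c, h⟩

/-- The projection of the chamber `d` onto the `i`-panel of `c`: the chamber of that panel which is
closest to `d`. -/
noncomputable def proj (i : I) (c d : Δ) : Δ := (hC.exists_adj_not_isLeftDescent i c d).choose

theorem adj_proj (i : I) (c d : Δ) : C.adj i c (hC.proj i c d) :=
  (hC.exists_adj_not_isLeftDescent i c d).choose_spec.1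

theorem not_isLeftDescent_dist_proj (i : I) (c d : Δ) :
    ¬(cs).IsLeftDescent (hC.dist (hC.proj i c d) d) i :=
  (hC.exists_adj_not_isLeftDescent i c d).choose_spec.2

theorem proj_eq {i : I} {c d p : Δ} (hadj : C.adj i c p)
    (h : ¬(cs).IsLeftDescent (hC.dist p d) i) : hC.proj i c d = p := by
  by_contra hne
  exact hC.not_isLeftDescent_dist_proj i c d <|
    hC.isLeftDescent_dist ((C.adj i).trans ((C.adj i).symm (hC.adj_proj i c d)) hadj) hne h

theorem proj_of_adj {i : I} {c d : Δ} (h : C.adj i c d) : hC.proj i c d = d :=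
  hC.proj_eq h (by rw [hC.dist_self]; exact (cs).not_isLeftDescent_one i)

theorem proj_congr {i : I} {c c' : Δ} (h : C.adj i c c') (d : Δ) :
    hC.proj i c d = hC.proj i c' d :=
  hC.proj_eq ((C.adj i).trans h (hC.adj_proj i c' d)) (hC.not_isLeftDescent_dist_proj i c' d)

theorem proj_map (g : C.aut) (i : I) (c d : Δ) :
    hC.proj i (g.1 c) (g.1 d) = g.1 (hC.proj i c d) :=
  hC.proj_eq ((g.2 _ _ _).2 (hC.adj_proj i c d)) <| by
    rw [hC.dist_map]
    exact hC.not_isLeftDescent_dist_proj i c d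

theorem reflTransGen_adj_of_proj_eq (i : I) (c d : Δ) :
    Relation.ReflTransGen
      (fun e e' => (∃ j, C.adj j e e') ∧ hC.proj i c e' = hC.proj i c d) (hC.proj i c d) d := by
  set p := hC.proj i c d
  obtain ⟨ω, hω, hgal⟩ := hC.exists_isGallery p d
  have hred : (cs).IsReduced (i :: ω) := isReduced_cons_iff.2
    ⟨hω, (hC.dist_eq_wordProd_iff hω).2 hgal ▸ hC.not_isLeftDescent_dist_proj i c d⟩
  have hp : C.adj i c p := hC.adj_proj i c d
  clear_value p
  clear hω
  generalize d = e at hgal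
  induction ω using List.reverseRecOn generalizing e with
  | nil => cases hgal; exact .refl
  | append_singleton ω j ih =>
    obtain ⟨e', he', hgal'⟩ := isGallery_append.1 hgal
    refine .tail (ih ?_ e' he') ⟨⟨j, (isGallery_singleton.1 hgal').1⟩, ?_⟩
    · exact (isReduced_append_singleton_iff (ω := i :: ω).1 hred).1
    · obtain ⟨hω, hi⟩ := isReduced_cons_iff.1 hred
      exact hC.proj_eq hp ((hC.dist_eq_wordProd_iff hω).2 hgal ▸ hi)

theorem proj_parallel (hM : M.IsRightAngled) {i j : I} {c d e : Δ} (hde : C.adj j d e)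
    (hne : hC.proj i c d ≠ hC.proj i c e) :
    i = j ∧ ∃ ω, (∀ k ∈ ω, k ≠ i) ∧ C.IsGallery (hC.proj i c d) ω d := by
  set p := hC.proj i c d
  have hadj : C.adj i p (hC.proj i c e) :=
    (C.adj i).trans ((C.adj i).symm (hC.adj_proj i c d)) (hC.adj_proj i c e)
  have hd : ¬(cs).IsLeftDescent (hC.dist p d) i := hC.not_isLeftDescent_dist_proj i c d
  have he : (cs).IsLeftDescent (hC.dist p e) i :=
    hC.isLeftDescent_dist hadj hne (hC.not_isLeftDescent_dist_proj i c e)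
  obtain ⟨ω, hω, hgal⟩ := hC.exists_isGallery p d
  rcases hC.dist_eq_or_eq_mul_simple hde p with h | h
  · exact (hd (h ▸ he)).elim
  · rw [h] at he
    rw [(hC.dist_eq_wordProd_iff hω).2 hgal] at hd he
    obtain ⟨rfl, hcomm⟩ := forall_eq_two_of_isLeftDescent_mul hM hω hd he
    exact ⟨rfl, ω, fun k hk => (ne_of_eq_two (hcomm k hk)).symm, hgal⟩

end IsBuilding

end ChamberSystem
/-! ### Legal colourings -/

namespace LegalColouring

open ChamberSystem CoxeterWord

variable {I Δ : Type*} {C : ChamberSystem I Δ} {X : I → Type*} (l : LegalColouring C X)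

/-- The chamber of `i`-colour `x` in the `i`-panel of `c`. -/
noncomputable def move (c : Δ) (i : I) (x : X i) : Δ :=
  (l.panelEquiv (P := {d | C.adj i d c}) ⟨c, rfl⟩).symm x

theorem adj_move (c : Δ) (i : I) (x : X i) : C.adj i c (l.move c i x) :=
  (C.adj i).symm ((l.panelEquiv (P := {d | C.adj i d c}) ⟨c, rfl⟩).symm x).2

@[simp]
theorem colour_move_self (c : Δ) (i : I) (x : X i) : l.colour (l.move c i x) i = x :=
  (l.panelEquiv (P := {d | C.adj i d c}) ⟨c, rfl⟩).apply_symm_apply x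

variable {l} in
theorem eq_of_adj {c d : Δ} {i : I} (h : C.adj i c d) (hi : l.colour c i = l.colour d i) :
    c = d :=
  congrArg Subtype.val <| (l.bijective i {e | C.adj i e d} ⟨d, rfl⟩).injective
    (a₁ := ⟨c, h⟩) (a₂ := ⟨d, (C.adj i).refl d⟩) hi

theorem colour_eq_of_adj {i j : I} (hji : j ≠ i) {c d : Δ} (h : C.adj i c d) :
    l.colour c j = l.colour d j :=
  l.constant i {e | C.adj i e d} ⟨d, rfl⟩ j hji c h d ((C.adj i).refl d)

theorem colour_move_of_ne {i j : I} (hji : j ≠ i) (c : Δ) (x : X i) :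
    l.colour (l.move c i x) j = l.colour c j :=
  (l.colour_eq_of_adj hji (l.adj_move c i x)).symm

theorem move_eq_iff {c d : Δ} {i : I} {x : X i} :
    l.move c i x = d ↔ C.adj i c d ∧ l.colour d i = x := by
  constructor
  · rintro rfl
    exact ⟨l.adj_move c i x, l.colour_move_self c i x⟩
  · rintro ⟨h, rfl⟩
    exact eq_of_adj ((C.adj i).trans ((C.adj i).symm (l.adj_move c i _)) h)
      (l.colour_move_self c i _)

theorem adj_iff_exists_move {i : I} {c d : Δ} : C.adj i c d ↔ ∃ x, l.move c i x = d := by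
  simp [move_eq_iff]

@[simp]
theorem move_colour_self (c : Δ) (i : I) : l.move c i (l.colour c i) = c :=
  l.move_eq_iff.2 ⟨(C.adj i).refl c, rfl⟩

@[simp]
theorem move_move (c : Δ) (i : I) (x y : X i) : l.move (l.move c i x) i y = l.move c i y :=
  l.move_eq_iff.2
    ⟨(C.adj i).trans ((C.adj i).symm (l.adj_move c i x)) (l.adj_move c i y), by simp⟩

/-- The chamber reached from `c` by following a coloured word: the letter `⟨i, x⟩` leads to the
chamber of colour `x` in the current `i`-panel, which may be the current chamber. -/
noncomputable def walk (c : Δ) (w : List (Σ i, X i)) : Δ :=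
  w.foldl (fun c a => l.move c a.1 a.2) c

@[simp]
theorem walk_cons (c : Δ) (a : Σ i, X i) (w : List (Σ i, X i)) :
    l.walk c (a :: w) = l.walk (l.move c a.1 a.2) w := rfl

theorem walk_append (c : Δ) (w v : List (Σ i, X i)) :
    l.walk c (w ++ v) = l.walk (l.walk c w) v := List.foldl_append

/-- Every step of the walk from `c` changes the chamber. -/
def NonStuttering : Δ → List (Σ i, X i) → Prop
  | _, [] => True
  | c, a :: w => l.colour c a.1 ≠ a.2 ∧ NonStuttering (l.move c a.1 a.2) w

variable {l} in
theorem NonStuttering.isGallery {c : Δ} {w : List (Σ i, X i)} (h : l.NonStuttering c w) :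
    C.IsGallery c (w.map Sigma.fst) (l.walk c w) := by
  induction w generalizing c with
  | nil => exact .nil c
  | cons a w ih =>
    refine .cons (l.adj_move c a.1 a.2) (fun hc => h.1 ?_) (ih h.2)
    rw [hc, colour_move_self]

variable {M : CoxeterMatrix I} (hC : C.IsBuilding M) (hM : M.IsRightAngled)

section Walks

include hC

theorem exists_walk_eq (c d : Δ) : ∃ w, l.walk c w = d := by
  induction hC.reflTransGen_adj c d with
  | refl => exact ⟨[], rfl⟩
  | tail _ hadj ih =>
    obtain ⟨w, rfl⟩ := ih
    obtain ⟨i, hadj⟩ := hadj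
    obtain ⟨x, rfl⟩ := l.adj_iff_exists_move.1 hadj
    exact ⟨w ++ [⟨i, x⟩], l.walk_append c w _⟩

include hM

theorem move_comm {i j : I} (h : M i j = 2) (c : Δ) (x : X i) (y : X j) :
    l.move (l.move c i x) j y = l.move (l.move c j y) i x := by
  have hij := ne_of_eq_two h
  by_cases hx : l.colour c i = x
  · subst hx
    rw [move_colour_self, ← l.colour_move_of_ne hij c y, move_colour_self]
  by_cases hy : l.colour c j = y
  · subst hy
    rw [move_colour_self, ← l.colour_move_of_ne hij.symm c x, move_colour_self]
  have hgal : C.IsGallery c [i, j] (l.move (l.move c i x) j y) :=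
    NonStuttering.isGallery (w := [⟨i, x⟩, ⟨j, y⟩])
      ⟨hx, by rwa [l.colour_move_of_ne hij.symm], trivial⟩
  have hgal' : C.IsGallery c ([j] ++ [i]) (l.move (l.move c i x) j y) := by
    rw [← hC.dist_eq_wordProd_iff (isReduced_pair hM hij)] at hgal
    refine (hC.dist_eq_wordProd_iff (isReduced_pair hM hij.symm)).1 (hgal.trans ?_)
    simpa [CoxeterSystem.wordProd_cons] using simple_mul_simple_comm M.toCoxeterSystem h
  obtain ⟨d, hcd, hd⟩ := isGallery_append.1 hgal'
  rw [isGallery_singleton] at hcd hd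
  obtain rfl : l.move c j y = d :=
    l.move_eq_iff.2 ⟨hcd.1, by rw [l.colour_eq_of_adj hij.symm hd.1, colour_move_self]⟩
  exact (l.move_eq_iff.2 ⟨hd.1, by rw [l.colour_move_of_ne hij, colour_move_self]⟩).symm

theorem walk_move_of_exposed {i : I} {w : List (Σ i, X i)} (h : Exposed M i (w.map Sigma.fst))
    (c : Δ) (x : X i) : l.walk (l.move c i x) w = l.walk c w := by
  induction w generalizing c with
  | nil => exact h.elim
  | cons a w ih =>
    obtain ⟨j, y⟩ := a
    rcases h with rfl | ⟨hij, h⟩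
    · rw [walk_cons, walk_cons, move_move]
    · rw [walk_cons, walk_cons, l.move_comm hC hM hij, ih h]

end Walks

section Uniqueness

variable {Δ' : Type*} {C' : ChamberSystem I Δ'} {l} {l' : LegalColouring C' X}
  (hC' : C'.IsBuilding M) {c : Δ} {d : Δ'}

theorem colour_move_congr (h : l.colour c = l'.colour d) (i : I) (x : X i) :
    l.colour (l.move c i x) = l'.colour (l'.move d i x) := by
  funext j
  rcases eq_or_ne j i with rfl | hj
  · simp
  · rw [l.colour_move_of_ne hj, l'.colour_move_of_ne hj, h]

theorem colour_walk_congr (h : l.colour c = l'.colour d) (w : List (Σ i, X i)) :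
    l.colour (l.walk c w) = l'.colour (l'.walk d w) := by
  induction w generalizing c d with
  | nil => exact h
  | cons a _ ih => exact ih (colour_move_congr h a.1 a.2)

include hC hM hC'

theorem exists_shorter_walk (h : l.colour c = l'.colour d) {w : List (Σ i, X i)}
    (hw : ¬(l.NonStuttering c w ∧ M.toCoxeterSystem.IsReduced (w.map Sigma.fst))) :
    ∃ v : List (Σ i, X i), v.length < w.length ∧
      l.walk c w = l.walk c v ∧ l'.walk d w = l'.walk d v := by
  induction w generalizing c d with
  | nil => exact (hw ⟨trivial, by simp [CoxeterSystem.IsReduced]⟩).elim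
  | cons a w ih =>
    obtain ⟨i, x⟩ := a
    by_cases hx : l.colour c i = x
    · subst hx
      refine ⟨w, by simp, by simp, ?_⟩
      rw [h, walk_cons, move_colour_self]
    by_cases hred : l.NonStuttering (l.move c i x) w ∧
        M.toCoxeterSystem.IsReduced (w.map Sigma.fst)
    · have hi : Exposed M i (w.map Sigma.fst) := by
        by_contra hi
        rw [← isLeftDescent_iff_exposed hM hred.2] at hi
        exact hw ⟨⟨hx, hred.1⟩, isReduced_cons_iff.2 ⟨hred.2, hi⟩⟩
      exact ⟨w, by simp, l.walk_move_of_exposed hC hM hi c x,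
        l'.walk_move_of_exposed hC' hM hi d x⟩
    · obtain ⟨v, hlen, hv, hv'⟩ := ih (colour_move_congr h i x) hred
      exact ⟨⟨i, x⟩ :: v, by simpa using hlen, hv, hv'⟩

theorem walk_eq_self_of_walk_eq_self (h : l.colour c = l'.colour d) {w : List (Σ i, X i)}
    (hw : l.walk c w = c) : l'.walk d w = d := by
  induction hn : w.length using Nat.strong_induction_on generalizing w with
  | _ n ih =>
    by_cases hred : l.NonStuttering c w ∧ M.toCoxeterSystem.IsReduced (w.map Sigma.fst)
    · have hgal := hred.1.isGallery
      rw [hw, ← hC.dist_eq_wordProd_iff hred.2, hC.dist_self] at hgal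
      have hlen := hred.2.eq
      rw [← hgal, CoxeterSystem.length_one, List.length_map, eq_comm,
        List.length_eq_zero_iff] at hlen
      rw [hlen]
      rfl
    · obtain ⟨v, hlen, hv, hv'⟩ := exists_shorter_walk hC hM hC' h hred
      rw [hv']
      exact ih v.length (hn ▸ hlen) (hv ▸ hw) rfl

theorem walk_eq_walk_of_walk_eq_walk (h : l.colour c = l'.colour d) {w v : List (Σ i, X i)}
    (hwv : l.walk c w = l.walk c v) : l'.walk d w = l'.walk d v := by
  obtain ⟨u, hu⟩ := l.exists_walk_eq hC (l.walk c v) c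
  have hwu : l'.walk (l'.walk d w) u = d := by
    rw [← walk_append]
    exact walk_eq_self_of_walk_eq_self hC hM hC' h (by rw [walk_append, hwv, hu])
  have huv : l'.walk (l'.walk d w) (u ++ v) = l'.walk d w :=
    walk_eq_self_of_walk_eq_self hC hM hC' (colour_walk_congr h w)
      (by rw [walk_append, hwv, hu])
  rw [← huv, walk_append, hwu]

theorem walk_eq_walk_iff (h : l.colour c = l'.colour d) {w v : List (Σ i, X i)} :
    l.walk c w = l.walk c v ↔ l'.walk d w = l'.walk d v :=
  ⟨walk_eq_walk_of_walk_eq_walk hC hM hC' h, walk_eq_walk_of_walk_eq_walk hC' hM hC h.symm⟩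

theorem exists_equiv_of_colour_eq (h : l.colour c = l'.colour d) :
    ∃ φ : Δ ≃ Δ', φ c = d ∧ (∀ i a b, C'.adj i (φ a) (φ b) ↔ C.adj i a b) ∧
      ∀ e, l'.colour (φ e) = l.colour e := by
  choose w hw using l.exists_walk_eq hC c
  have hφ (v : List (Σ i, X i)) : l'.walk d (w (l.walk c v)) = l'.walk d v :=
    (walk_eq_walk_iff hC hM hC' h).1 (hw _)
  have hbij : Function.Bijective fun e => l'.walk d (w e) := by
    refine ⟨fun a b hab => ?_, fun e => ?_⟩
    · rw [← hw a, ← hw b]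
      exact (walk_eq_walk_iff hC hM hC' h).2 hab
    · obtain ⟨v, rfl⟩ := l'.exists_walk_eq hC' d e
      exact ⟨_, hφ v⟩
  refine ⟨.ofBijective _ hbij, hφ [], fun i a b => ?_, fun e => ?_⟩
  · rw [l'.adj_iff_exists_move, l.adj_iff_exists_move]
    refine exists_congr fun x => ?_
    have := walk_eq_walk_iff hC hM hC' h (w := w a ++ [⟨i, x⟩]) (v := w b)
    rw [walk_append, walk_append, hw a, hw b] at this
    exact this.symm
  · exact (colour_walk_congr h (w e)).symm.trans (by rw [hw])

end Uniqueness

end LegalColouring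
/-! ### Universal groups -/

namespace LegalColouring

open ChamberSystem

variable {I Δ : Type*} {C : ChamberSystem I Δ} {X : I → Type*} (l : LegalColouring C X)
  {F : ∀ i, Subgroup (Equiv.Perm (X i))}

variable {l} in
theorem adj_smul_iff (g : l.universalGroup F) {i : I} {c d : Δ} :
    C.adj i (g • c) (g • d) ↔ C.adj i c d := g.1.2 i c d

theorem mem_universalGroup_iff {g : C.aut} :
    g ∈ l.universalGroup F ↔
      ∀ i c, ∃ f : F i, ∀ d, C.adj i c d → l.colour (g • d) i = f • l.colour d i := by
  constructor
  · intro hg i c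
    have hP : {d | C.adj i d c} ∈ C.panels i := ⟨c, rfl⟩
    exact ⟨⟨_, hg i _ hP⟩, fun d hd => (l.localAction_colour g hP ((C.adj i).symm hd)).symm⟩
  · rintro hg i _ ⟨c, rfl⟩
    obtain ⟨f, hf⟩ := hg i c
    rw [l.localAction_eq g ⟨c, rfl⟩ (f := f) fun d hd => (hf d ((C.adj i).symm hd)).symm]
    exact f.2

/-- The legal colouring obtained from `l` by applying to the `i`-colours on each `i`-panel a
permutation that depends on the panel. -/
def recolour (col : Δ → ∀ i, X i)
    (hlocal : ∀ i c, ∃ f : Equiv.Perm (X i), ∀ d, C.adj i c d → col d i = f (l.colour d i))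
    (hconst : ∀ i j, j ≠ i → ∀ c d, C.adj i c d → col c j = col d j) : LegalColouring C X where
  colour := col
  bijective := by
    rintro i _ ⟨c, rfl⟩
    obtain ⟨f, hf⟩ := hlocal i c
    convert f.bijective.comp (l.bijective i {d | C.adj i d c} ⟨c, rfl⟩) using 1
    exact funext fun d => hf d ((C.adj i).symm d.2)
  constant := by
    rintro i _ ⟨c, rfl⟩ j hj d hd e he
    exact hconst i j hj d e ((C.adj i).trans hd ((C.adj i).symm he))

variable {l} in
theorem universalGroup_ext {g h : l.universalGroup F} {M : CoxeterMatrix I} (hC : C.IsBuilding M)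
    {c : Δ} (hc : g • c = h • c) (hcol : ∀ d, l.colour (g • d) = l.colour (h • d)) : g = h := by
  refine Subtype.ext (Subtype.ext (Equiv.ext fun d => ?_))
  change g • d = h • d
  induction hC.reflTransGen_adj c d with
  | refl => exact hc
  | @tail d e _ hadj ih =>
    obtain ⟨i, hadj⟩ := hadj
    refine eq_of_adj (l := l) (i := i) ?_ (congrFun (hcol e) i)
    exact (C.adj i).trans ((C.adj i).symm ((adj_smul_iff g).2 hadj))
      (ih ▸ (adj_smul_iff h).2 hadj)

variable {M : CoxeterMatrix I} (hC : C.IsBuilding M) (hM : M.IsRightAngled)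
include hC hM

theorem exists_smul_eq_and_colour_smul {col : Δ → ∀ i, X i}
    (hlocal : ∀ i c, ∃ f : F i, ∀ d, C.adj i c d → col d i = f • l.colour d i)
    (hconst : ∀ i j, j ≠ i → ∀ c d, C.adj i c d → col c j = col d j)
    {c d : Δ} (hd : l.colour d = col c) :
    ∃ g : l.universalGroup F, g • c = d ∧ ∀ e, l.colour (g • e) = col e := by
  let l' := l.recolour col (fun i c => (hlocal i c).imp' Subtype.val fun _ h => h) hconst
  obtain ⟨φ, hφ, hadj, hcol⟩ := exists_equiv_of_colour_eq (l := l') (l' := l) hC hM hC hd.symm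
  let g : C.aut := ⟨φ, hadj⟩
  have hg : g ∈ l.universalGroup F := l.mem_universalGroup_iff.2 fun i c =>
    (hlocal i c).imp fun f hf e he => (congrFun (hcol e) i).trans (hf e he)
  exact ⟨⟨g, hg⟩, hφ, hcol⟩

theorem exists_smul_eq {c d : Δ} (h : ∀ i, ∃ f : F i, l.colour d i = f • l.colour c i) :
    ∃ g : l.universalGroup F, g • c = d := by
  choose f hf using h
  obtain ⟨g, hg, -⟩ := l.exists_smul_eq_and_colour_smul hC hM
    (F := F) (col := fun e i => f i • l.colour e i) (fun i _ => ⟨f i, fun _ _ => rfl⟩)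
    (fun i j hj a b hab => by rw [l.colour_eq_of_adj hj hab]) (funext hf)
  exact ⟨g, hg⟩

theorem finite_orbitRel_quotient [Finite I]
    (horb : ∀ i, Finite (MulAction.orbitRel.Quotient (F i) (X i))) :
    Finite (MulAction.orbitRel.Quotient (l.universalGroup F) Δ) := by
  refine Finite.of_injective (β := ∀ i, MulAction.orbitRel.Quotient (F i) (X i))
    (fun q i => Quotient.mk _ (l.colour q.out i)) fun q q' h => ?_
  obtain ⟨g, hg⟩ := l.exists_smul_eq hC hM (F := F) (c := q'.out) (d := q.out) fun i => by
    obtain ⟨f, hf⟩ := Quotient.exact (congrFun h i)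
    exact ⟨f, hf.symm⟩
  rw [← Quotient.out_eq q, ← Quotient.out_eq q']
  exact Quotient.sound ⟨g, hg⟩

end LegalColouring

/-! ### Extending local permutations to the building -/

section OrbitSection

variable {G X : Type*} [Group G] [MulAction G X]

variable (G) in
theorem exists_smul_out_eq (x : X) :
    ∃ g : G, g • (Quotient.out (s := MulAction.orbitRel G X) ⟦x⟧) = x :=
  (MulAction.orbitRel G X).symm (Quotient.mk_out (s := MulAction.orbitRel G X) x)

variable (G) in
/-- A group element carrying the chosen representative of the orbit of `x` to `x`. -/
noncomputable def orbitSection (x : X) : G := (exists_smul_out_eq G x).choose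

variable (G) in
theorem orbitSection_smul_out (x : X) :
    orbitSection G x • Quotient.out (s := MulAction.orbitRel G X) ⟦x⟧ = x :=
  (exists_smul_out_eq G x).choose_spec

variable (G) in
theorem orbitSection_inv_smul (x : X) :
    (orbitSection G x)⁻¹ • x = Quotient.out (s := MulAction.orbitRel G X) ⟦x⟧ :=
  inv_smul_eq_iff.2 (orbitSection_smul_out G x).symm

theorem orbitSection_smul_mul_inv_smul (g : G) (x : X) :
    (orbitSection G (g • x) * (orbitSection G x)⁻¹) • x = g • x := by
  have horbit : (Quotient.mk (MulAction.orbitRel G X) (g • x)) = ⟦x⟧ :=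
    Quotient.sound (MulAction.mem_orbit x g)
  rw [mul_smul, orbitSection_inv_smul, ← horbit, orbitSection_smul_out]

end OrbitSection

namespace LegalColouring

open ChamberSystem

variable {I Δ : Type*} {C : ChamberSystem I Δ} {X : I → Type*} (l : LegalColouring C X)
  {F : ∀ i, Subgroup (Equiv.Perm (X i))} {M : CoxeterMatrix I} (hC : C.IsBuilding M)
  (hM : M.IsRightAngled) (c : Δ) {i : I}

theorem colour_eq_of_isGallery {ω : List I} (hω : ∀ j ∈ ω, j ≠ i) {c d : Δ}
    (h : C.IsGallery c ω d) : l.colour c i = l.colour d i := by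
  induction h with
  | nil => rfl
  | cons hadj _ _ ih =>
    rw [List.forall_mem_cons] at hω
    rw [l.colour_eq_of_adj hω.1.symm hadj, ih hω.2]

variable (i) in
/-- The wings of the `i`-panel of `c` are the fibres of the projection onto it; they are labelled
here by the `i`-colour of the projection. -/
noncomputable def wingColour (d : Δ) : X i := l.colour (hC.proj i c d) i

variable {l c hC} in
theorem wingColour_of_adj {d : Δ} (h : C.adj i c d) : l.wingColour hC c i d = l.colour d i := by
  rw [wingColour, hC.proj_of_adj h]

theorem wingColour_smul {g : l.universalGroup F} {f : F i} (hc : C.adj i c (g • c))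
    (hf : ∀ d, C.adj i c d → l.colour (g • d) i = f • l.colour d i) (d : Δ) :
    l.wingColour hC c i (g • d) = f • l.wingColour hC c i d := by
  have hproj : hC.proj i c (g • d) = g • hC.proj i c d :=
    (hC.proj_congr hc _).trans (hC.proj_map _ i c d)
  rw [wingColour, hproj, hf _ (hC.adj_proj i c d), wingColour]

variable {l c hC} in
include hM in
theorem eq_and_colour_eq_of_wingColour_ne {j : I} {d e : Δ} (hde : C.adj j d e)
    (hne : l.wingColour hC c i d ≠ l.wingColour hC c i e) :
    i = j ∧ l.colour d i = l.wingColour hC c i d := by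
  obtain ⟨rfl, ω, hω, hgal⟩ := hC.proj_parallel hM hde (ne_of_apply_ne (fun p => l.colour p i) hne)
  exact ⟨rfl, (l.colour_eq_of_isGallery hω hgal).symm⟩

open scoped Classical in
/-- The colouring that arises from `l` when the wings of the `i`-panel of `c` are permuted by `f`;
the `i`-colours in a wing are shifted by one element of `F i` chosen for that wing. -/
noncomputable def wingShift (f : F i) (d : Δ) : ∀ j, X j :=
  Function.update (l.colour d) i
    ((orbitSection (F i) (f • l.wingColour hC c i d) *
      (orbitSection (F i) (l.wingColour hC c i d))⁻¹) • l.colour d i)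

theorem wingShift_self (f : F i) (d : Δ) :
    l.wingShift hC c f d i = (orbitSection (F i) (f • l.wingColour hC c i d) *
      (orbitSection (F i) (l.wingColour hC c i d))⁻¹) • l.colour d i := by
  simp [wingShift]

theorem wingShift_of_ne {j : I} (hj : j ≠ i) (f : F i) (d : Δ) :
    l.wingShift hC c f d j = l.colour d j := by
  simp [wingShift, hj]

theorem wingShift_of_colour_eq (f : F i) {d : Δ} (h : l.colour d i = l.wingColour hC c i d) :
    l.wingShift hC c f d i = f • l.colour d i := by
  rw [wingShift_self, h, orbitSection_smul_mul_inv_smul]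

include hM in
theorem exists_wingShift_eq_smul (f : F i) (j : I) (d : Δ) :
    ∃ f' : F j, ∀ e, C.adj j d e → l.wingShift hC c f e j = f' • l.colour e j := by
  rcases eq_or_ne j i with rfl | hj
  · by_cases hwing : ∀ e, C.adj j d e → l.wingColour hC c j e = l.wingColour hC c j d
    · exact ⟨_, fun e he => by rw [wingShift_self, hwing e he]⟩
    · push Not at hwing
      obtain ⟨d', hd', hne⟩ := hwing
      refine ⟨f, fun e he => l.wingShift_of_colour_eq hC c f ?_⟩
      by_cases hed : l.wingColour hC c j e = l.wingColour hC c j d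
      · exact (eq_and_colour_eq_of_wingColour_ne hM
          ((C.adj j).trans ((C.adj j).symm he) hd') (hed ▸ hne.symm)).2
      · exact (eq_and_colour_eq_of_wingColour_ne hM ((C.adj j).symm he) hed).2
  · exact ⟨1, fun e _ => by rw [l.wingShift_of_ne hC c hj, one_smul]⟩

include hM in
theorem wingShift_eq_of_adj (f : F i) {j k : I} (hjk : j ≠ k) {d e : Δ} (h : C.adj k d e) :
    l.wingShift hC c f d j = l.wingShift hC c f e j := by
  rcases eq_or_ne j i with rfl | hj
  · have hwing : l.wingColour hC c j d = l.wingColour hC c j e := by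
      by_contra hne
      exact hjk (eq_and_colour_eq_of_wingColour_ne hM h hne).1
    rw [wingShift_self, wingShift_self, hwing, l.colour_eq_of_adj hjk h]
  · rw [l.wingShift_of_ne hC c hj, l.wingShift_of_ne hC c hj, l.colour_eq_of_adj hjk h]

include hM in
theorem exists_colour_smul_eq_wingShift (f : F i) :
    ∃ g : l.universalGroup F, g • c = l.move c i (f • l.colour c i) ∧
      ∀ d, l.colour (g • d) = l.wingShift hC c f d := by
  refine l.exists_smul_eq_and_colour_smul hC hM (l.exists_wingShift_eq_smul hC hM c f)
    (fun _ _ hjk _ _ h => l.wingShift_eq_of_adj hC hM c f hjk h) (funext fun j => ?_)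
  rcases eq_or_ne j i with rfl | hj
  · rw [colour_move_self, l.wingShift_of_colour_eq hC c f
      (wingColour_of_adj ((C.adj j).refl c)).symm]
  · rw [l.colour_move_of_ne hj, l.wingShift_of_ne hC c hj]

/-- The element of the universal group that permutes the wings of the `i`-panel of `c` by `f`. -/
noncomputable def panelExtension (f : F i) : l.universalGroup F :=
  (l.exists_colour_smul_eq_wingShift hC hM c f).choose

theorem colour_panelExtension_smul (f : F i) (d : Δ) :
    l.colour (l.panelExtension hC hM c f • d) = l.wingShift hC c f d :=
  (l.exists_colour_smul_eq_wingShift hC hM c f).choose_spec.2 d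

theorem panelExtension_smul_of_adj (f : F i) {d : Δ} (h : C.adj i c d) :
    l.panelExtension hC hM c f • d = l.move c i (f • l.colour d i) := by
  have hc := (l.exists_colour_smul_eq_wingShift hC hM c f).choose_spec.1
  refine (l.move_eq_iff.2 ⟨?_, ?_⟩).symm
  · exact (C.adj i).trans (l.adj_move c i _) (hc ▸ (adj_smul_iff _).2 h)
  · rw [colour_panelExtension_smul, l.wingShift_of_colour_eq hC c f (wingColour_of_adj h).symm]

theorem wingColour_panelExtension_smul (f : F i) (d : Δ) :
    l.wingColour hC c i (l.panelExtension hC hM c f • d) = f • l.wingColour hC c i d := by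
  refine l.wingColour_smul hC c ?_ (fun e he => ?_) d
  · rw [l.panelExtension_smul_of_adj hC hM c f ((C.adj i).refl c)]
    exact l.adj_move c i _
  · rw [l.panelExtension_smul_of_adj hC hM c f he, colour_move_self]

theorem panelExtension_mul (f h : F i) :
    l.panelExtension hC hM c (f * h) = l.panelExtension hC hM c f * l.panelExtension hC hM c h := by
  refine universalGroup_ext hC (c := c) ?_ fun d => funext fun j => ?_
  · rw [mul_smul, l.panelExtension_smul_of_adj hC hM c h ((C.adj i).refl c),
      l.panelExtension_smul_of_adj hC hM c f (l.adj_move c i _), colour_move_self,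
      l.panelExtension_smul_of_adj hC hM c _ ((C.adj i).refl c), mul_smul]
  · rw [mul_smul, colour_panelExtension_smul, colour_panelExtension_smul]
    rcases eq_or_ne j i with rfl | hj
    · rw [wingShift_self, wingShift_self, wingColour_panelExtension_smul,
        colour_panelExtension_smul, wingShift_self]
      simp only [← mul_smul]
      group
    · rw [l.wingShift_of_ne hC c hj, l.wingShift_of_ne hC c hj, colour_panelExtension_smul,
        l.wingShift_of_ne hC c hj]

variable (i) in
/-- The extension of the permutations of the `i`-panel of `c` to the building, as a homomorphism. -/
noncomputable def panelExtensionHom : F i →* l.universalGroup F :=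
  .mk' (l.panelExtension hC hM c) (l.panelExtension_mul hC hM c)

theorem panelExtension_smul_eq_self {f : F i} {d : Δ}
    (h : f • l.wingColour hC c i d = l.wingColour hC c i d) :
    l.panelExtension hC hM c f • d = d := by
  suffices h' : ∀ e, Relation.ReflTransGen
      (fun e e' => (∃ j, C.adj j e e') ∧ hC.proj i c e' = hC.proj i c d) (hC.proj i c d) e →
        l.panelExtension hC hM c f • e = e from h' d (hC.reflTransGen_adj_of_proj_eq i c d)
  intro e he
  induction he with
  | refl =>
    refine (l.panelExtension_smul_of_adj hC hM c f (hC.adj_proj i c d)).trans ?_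
    exact l.move_eq_iff.2 ⟨hC.adj_proj i c d, h.symm⟩
  | @tail e e' _ hstep ih =>
    obtain ⟨⟨j, hadj⟩, hproj⟩ := hstep
    refine eq_of_adj (l := l) (i := j)
      ((C.adj j).trans ((C.adj j).symm ((adj_smul_iff _).2 hadj)) (ih.symm ▸ hadj)) ?_
    rw [colour_panelExtension_smul]
    rcases eq_or_ne j i with rfl | hj
    · have hwing : l.wingColour hC c j e' = l.wingColour hC c j d := by
        rw [wingColour, hproj, wingColour]
      rw [wingShift_self, hwing, h, mul_inv_cancel, one_smul]
    · rw [l.wingShift_of_ne hC c hj]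

end LegalColouring

/-! ### Finite generation over a subgroup -/

section FiniteOver

variable {G : Type*} [Group G] {H H' K K' : Subgroup G}

/-- The subgroup `K` is finitely generated over `H`: it is contained in a subgroup that is generated
by `H` and finitely many elements. Neither are these required to lie in `K`, nor `H` in `K`. -/
def FiniteOver (H K : Subgroup G) : Prop := ∃ A : Set G, A.Finite ∧ K ≤ H ⊔ Subgroup.closure A

namespace FiniteOver

theorem of_le (h : K ≤ H) : FiniteOver H K := ⟨∅, Set.finite_empty, h.trans le_sup_left⟩

theorem closure {A : Set G} (hA : A.Finite) : FiniteOver H (Subgroup.closure A) :=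
  ⟨A, hA, le_sup_right⟩

theorem mono (h : FiniteOver H K) (hK : K' ≤ K) : FiniteOver H K' :=
  h.imp fun _ hA => hA.imp_right hK.trans

theorem mono_left (h : FiniteOver H K) (hH : H ≤ H') : FiniteOver H' K :=
  h.imp fun _ hA => hA.imp_right fun hK => hK.trans (sup_le_sup_right hH _)

theorem map {G' : Type*} [Group G'] (h : FiniteOver H K) (φ : G →* G') :
    FiniteOver (H.map φ) (K.map φ) := by
  obtain ⟨A, hA, hK⟩ := h
  refine ⟨φ '' A, hA.image φ, ?_⟩
  rw [← MonoidHom.map_closure, ← Subgroup.map_sup]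
  exact Subgroup.map_mono hK

theorem iSup {ι : Type*} [Finite ι] {K : ι → Subgroup G} (h : ∀ i, FiniteOver H (K i)) :
    FiniteOver H (⨆ i, K i) := by
  choose A hA hK using h
  exact ⟨⋃ i, A i, Set.finite_iUnion hA, iSup_le fun i => (hK i).trans
    (sup_le_sup_left (Subgroup.closure_mono (Set.subset_iUnion A i)) H)⟩

theorem sup (h : FiniteOver H K) (h' : FiniteOver H K') : FiniteOver H (K ⊔ K') := by
  rw [sup_eq_iSup]
  exact iSup (Bool.forall_bool.2 ⟨h', h⟩)

end FiniteOver

variable {Δ : Type*} [MulAction G Δ] {r : Δ → Δ → Prop}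

theorem eq_top_of_reflTransGen (hr : ∀ (g : G) c d, r c d → r (g • c) (g • d))
    (hconn : ∀ c d, Relation.ReflTransGen r c d) {S : Set Δ} (hS : S.Nonempty)
    (hK : ∀ c ∈ S, ∀ g : G, g • c ∈ S → g ∈ K)
    (hstep : ∀ c ∈ S, ∀ d, r c d → ∃ k ∈ K, k • d ∈ S) : K = ⊤ := by
  obtain ⟨c, hc⟩ := hS
  have hreach (d : Δ) : ∃ k ∈ K, k • d ∈ S := by
    induction hconn c d with
    | refl => exact ⟨1, one_mem K, by rwa [one_smul]⟩
    | tail _ hde ih =>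
      obtain ⟨k, hk, hkd⟩ := ih
      obtain ⟨k', hk', hkd'⟩ := hstep _ hkd _ (hr k _ _ hde)
      exact ⟨k' * k, mul_mem hk' hk, by rwa [mul_smul]⟩
  refine (Subgroup.eq_top_iff' K).2 fun g => ?_
  obtain ⟨k, hk, hkg⟩ := hreach (g • c)
  exact (Subgroup.mul_mem_cancel_left K hk).1 (hK c hc _ (by rwa [mul_smul]))

theorem finiteOver_top_of_reflTransGen [Nonempty Δ] [Finite (MulAction.orbitRel.Quotient G Δ)]
    (hr : ∀ (g : G) c d, r c d → r (g • c) (g • d)) (hconn : ∀ c d, Relation.ReflTransGen r c d)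
    (hstab : ∀ c : Δ, FiniteOver H (MulAction.stabilizer G c))
    {K : Δ → Subgroup G} (hK : ∀ c, FiniteOver H (K c)) {D : Δ → Set Δ} (hD : ∀ c, (D c).Finite)
    (hstep : ∀ c d, r c d → ∃ k ∈ K c, k • d ∈ D c) : FiniteOver H (⊤ : Subgroup G) := by
  let Q := MulAction.orbitRel.Quotient G Δ
  let A : Set G := (fun d => (orbitSection G d)⁻¹) '' ⋃ q : Q, D q.out
  let L := ((⨆ q : Q, MulAction.stabilizer G q.out) ⊔ ⨆ q : Q, K q.out) ⊔ Subgroup.closure A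
  have hA : A.Finite := (Set.finite_iUnion fun _ => hD _).image _
  have hL : FiniteOver H L :=
    ((FiniteOver.iSup fun _ => hstab _).sup (.iSup fun _ => hK _)).sup (.closure hA)
  suffices hL_top : L = ⊤ by rwa [hL_top] at hL
  refine eq_top_of_reflTransGen hr hconn (S := Set.range fun q : Q => q.out) ?_ ?_ ?_
  · obtain ⟨c⟩ := ‹Nonempty Δ›
    exact ⟨_, ⟦c⟧, rfl⟩
  · rintro _ ⟨q, rfl⟩ g ⟨q', hq'⟩
    obtain rfl : q' = q := by
      rw [← Quotient.out_eq q, ← Quotient.out_eq q']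
      exact Quotient.sound ⟨g, hq'.symm⟩
    exact Subgroup.mem_sup_left (Subgroup.mem_sup_left (Subgroup.mem_iSup_of_mem q' hq'.symm))
  · rintro _ ⟨q, rfl⟩ d hd
    obtain ⟨k, hk, hkd⟩ := hstep _ d hd
    refine ⟨(orbitSection G (k • d))⁻¹ * k, mul_mem ?_ ?_, ⟦k • d⟧, ?_⟩
    · exact Subgroup.mem_sup_right
        (Subgroup.subset_closure ⟨k • d, Set.mem_iUnion.2 ⟨q, hkd⟩, rfl⟩)
    · exact Subgroup.mem_sup_left (Subgroup.mem_sup_right (Subgroup.mem_iSup_of_mem q hk))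
    · exact (mul_smul _ k d).trans (orbitSection_inv_smul G (k • d)) |>.symm

end FiniteOver

/-! ### Compact generation in the permutation topology -/

section PermTopology

variable {Y : Type*}

theorem isOpen_setOf_perm_apply_mem (y : Y) (s : Set Y) :
    IsOpen {g : Equiv.Perm Y | g y ∈ s} := by
  refine fun g hg => ⟨{y}, fun h hh => ?_⟩
  have hy : h y = y := (mem_fixingSubgroup_iff _).1 hh y (by simp)
  rwa [Set.mem_ofPred_eq, Equiv.Perm.mul_apply, hy]

variable {G : Type*} [Group G] [TopologicalSpace G] [MulAction G Y]

theorem isClopen_setOf_smul_eq (hG : Continuous (MulAction.toPermHom G Y)) (y z : Y) :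
    IsClopen {g : G | g • y = z} :=
  ⟨⟨(isOpen_setOf_perm_apply_mem y {z}ᶜ).preimage hG⟩,
    (isOpen_setOf_perm_apply_mem y {z}).preimage hG⟩

theorem IsCompactlyGeneratedGroup.finiteOver_fixingSubgroup (h : IsCompactlyGeneratedGroup G)
    (hG : Continuous (MulAction.toPermHom G Y)) {Φ : Set Y} (hΦ : Φ.Finite) :
    FiniteOver (fixingSubgroup G Φ) ⊤ := by
  obtain ⟨S, hS, hgen⟩ := h
  have hopen (g₀ : G) : IsOpen (⋂ y ∈ Φ, {g : G | g • y = g₀ • y}) :=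
    hΦ.isOpen_biInter fun y _ => (isClopen_setOf_smul_eq hG y (g₀ • y)).isOpen
  obtain ⟨A, -, hA⟩ := hS.elim_nhds_subcover (fun g₀ => ⋂ y ∈ Φ, {g : G | g • y = g₀ • y})
    fun g₀ _ => (hopen g₀).mem_nhds (by simp)
  refine ⟨A, A.finite_toSet, ?_⟩
  rw [← hgen, Subgroup.closure_le]
  intro g hg
  obtain ⟨a, ha, hga⟩ := Set.mem_iUnion₂.1 (hA hg)
  rw [← mul_inv_cancel_left a g]
  refine mul_mem (Subgroup.mem_sup_right (Subgroup.subset_closure ha)) (Subgroup.mem_sup_left ?_)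
  refine (mem_fixingSubgroup_iff _).2 fun y hy => ?_
  rw [mul_smul, inv_smul_eq_iff]
  exact Set.mem_iInter₂.1 hga y hy

theorem exists_finite_isCompact_fixingSubgroup [WeaklyLocallyCompactSpace G]
    (hG : Topology.IsInducing (MulAction.toPermHom G Y)) :
    ∃ Φ : Set Y, Φ.Finite ∧ IsCompact (fixingSubgroup G Φ : Set G) := by
  obtain ⟨K, hK, hK1⟩ := exists_compact_mem_nhds (1 : G)
  obtain ⟨V, hVK, hVopen, h1⟩ := mem_nhds_iff.1 hK1
  obtain ⟨V, hV, rfl⟩ := hG.isOpen_iff.1 hVopen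
  obtain ⟨Φ, hΦ⟩ := hV 1 (map_one (MulAction.toPermHom G Y) ▸ h1)
  refine ⟨Φ, Φ.finite_toSet, hK.of_isClosed_subset ?_ fun g hg => hVK ?_⟩
  · have hfix : (fixingSubgroup G (Φ : Set Y) : Set G) = ⋂ y ∈ Φ, {g : G | g • y = y} := by
      ext g
      simp [mem_fixingSubgroup_iff]
    rw [hfix]
    exact isClosed_biInter fun y _ => (isClopen_setOf_smul_eq hG.continuous y y).isClosed
  · have hgV := hΦ (MulAction.toPermHom G Y g) <| (mem_fixingSubgroup_iff _).2 fun y hy =>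
      (mem_fixingSubgroup_iff _).1 hg y hy
    rwa [one_mul] at hgV

theorem isCompactlyGeneratedGroup_of_finiteOver_fixingSubgroup [WeaklyLocallyCompactSpace G]
    (hG : Topology.IsInducing (MulAction.toPermHom G Y))
    (h : ∀ Φ : Set Y, Φ.Finite → FiniteOver (fixingSubgroup G Φ) ⊤) :
    IsCompactlyGeneratedGroup G := by
  obtain ⟨Φ, hΦ, hcompact⟩ := exists_finite_isCompact_fixingSubgroup hG
  obtain ⟨A, hA, htop⟩ := h Φ hΦ
  refine ⟨_, hcompact.union hA.isCompact, ?_⟩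
  rw [Subgroup.closure_union, Subgroup.closure_eq]
  exact top_le_iff.1 htop

end PermTopology

/-! ### Generating the universal group -/

namespace LegalColouring

open ChamberSystem

variable {I Δ : Type*} {C : ChamberSystem I Δ} {X : I → Type*} (l : LegalColouring C X)
  {F : ∀ i, Subgroup (Equiv.Perm (X i))} {M : CoxeterMatrix I} (hC : C.IsBuilding M)
  (hM : M.IsRightAngled)

theorem finiteOver_range_panelExtensionHom {i : I} (hgen : IsCompactlyGeneratedGroup (F i))
    {Φ : Set Δ} (hΦ : Φ.Finite) (c : Δ) :
    FiniteOver (fixingSubgroup (l.universalGroup F) Φ) (l.panelExtensionHom hC hM c i).range := by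
  have hF := hgen.finiteOver_fixingSubgroup (Y := X i) continuous_subtype_val
    (hΦ.image (l.wingColour hC c i))
  rw [MonoidHom.range_eq_map]
  refine (hF.map _).mono_left (Subgroup.map_le_iff_le_comap.2 fun f hf => ?_)
  refine (mem_fixingSubgroup_iff _).2 fun d hd => l.panelExtension_smul_eq_self hC hM c ?_
  exact (mem_fixingSubgroup_iff _).1 hf _ (Set.mem_image_of_mem _ hd)

theorem fixingSubgroup_le_range_panelExtensionHom_sup {Ψ : Set Δ} {c d : Δ} {i : I} (hc : c ∈ Ψ)
    (hcd : C.adj i c d) :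
    fixingSubgroup (l.universalGroup F) Ψ ≤ (l.panelExtensionHom hC hM c i).range ⊔
      fixingSubgroup (l.universalGroup F) (insert d Ψ) := by
  intro g hg
  rw [mem_fixingSubgroup_iff] at hg
  have hgc : C.adj i c (g • c) := by rw [hg c hc]
  obtain ⟨f, hf⟩ := l.mem_universalGroup_iff.1 g.2 i c
  rw [← mul_inv_cancel_left (l.panelExtensionHom hC hM c i f) g]
  refine mul_mem (Subgroup.mem_sup_left ⟨f, rfl⟩) (Subgroup.mem_sup_right ?_)
  rw [mem_fixingSubgroup_iff]
  rintro e (rfl | he)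
  · rw [mul_smul, inv_smul_eq_iff]
    refine ((l.panelExtension_smul_of_adj hC hM c f hcd).trans (l.move_eq_iff.2 ⟨?_, ?_⟩)).symm
    · exact (C.adj i).trans hgc ((adj_smul_iff g).2 hcd)
    · exact hf e hcd
  · have hwing := l.wingColour_smul hC c hgc hf e
    rw [hg e he] at hwing
    rw [mul_smul, hg e he, inv_smul_eq_iff]
    exact (l.panelExtension_smul_eq_self hC hM c hwing.symm).symm

section

variable {H : Subgroup (l.universalGroup F)}
  (hH : ∀ c i, FiniteOver H (l.panelExtensionHom hC hM c i).range)
include hH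

theorem finiteOver_fixingSubgroup_of_insert {Ψ : Set Δ} {c : Δ} (hc : c ∈ Ψ) (d : Δ)
    (h : FiniteOver H (fixingSubgroup (l.universalGroup F) (insert d Ψ))) :
    FiniteOver H (fixingSubgroup (l.universalGroup F) Ψ) := by
  induction hC.reflTransGen_adj c d with
  | refl => rwa [Set.insert_eq_of_mem hc] at h
  | @tail d e _ hadj ih =>
    obtain ⟨i, hadj⟩ := hadj
    refine ih (((hH d i).sup (h.mono ?_)).mono
      (l.fixingSubgroup_le_range_panelExtensionHom_sup hC hM (Set.mem_insert d Ψ) hadj))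
    exact fixingSubgroup_antitone _ _ (Set.insert_subset_insert (Set.subset_insert d Ψ))

theorem finiteOver_stabilizer {Φ : Set Δ} (hΦ : Φ.Finite)
    (h : FiniteOver H (fixingSubgroup (l.universalGroup F) Φ)) (c : Δ) :
    FiniteOver H (MulAction.stabilizer (l.universalGroup F) c) := by
  replace h : FiniteOver H (fixingSubgroup (l.universalGroup F) (insert c Φ)) :=
    h.mono (fixingSubgroup_antitone _ _ (Set.subset_insert c Φ))
  induction Φ, hΦ using Set.Finite.induction_on with
  | empty =>
    refine h.mono fun g hg => (mem_fixingSubgroup_iff _).2 ?_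
    simpa using hg
  | @insert d Φ _ _ ih =>
    rw [Set.insert_comm] at h
    exact ih (l.finiteOver_fixingSubgroup_of_insert hC hM hH (Set.mem_insert c Φ) d h)

end

theorem panelExtensionHom_smul_mem_range {c d : Δ} {i : I} (hcd : C.adj i c d) :
    ∃ f : F i, l.panelExtensionHom hC hM c i f • d ∈
      Set.range fun q : MulAction.orbitRel.Quotient (F i) (X i) => l.move c i q.out :=
  ⟨(orbitSection (F i) (l.colour d i))⁻¹, ⟦l.colour d i⟧,
    (congrArg (l.move c i) (orbitSection_inv_smul (F i) (l.colour d i))).symm.trans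
      (l.panelExtension_smul_of_adj hC hM c _ hcd).symm⟩

include hC hM in
theorem finiteOver_fixingSubgroup_top [Finite I] (hgen : ∀ i, IsCompactlyGeneratedGroup (F i))
    (horb : ∀ i, Finite (MulAction.orbitRel.Quotient (F i) (X i))) {Φ : Set Δ} (hΦ : Φ.Finite) :
    FiniteOver (fixingSubgroup (l.universalGroup F) Φ) ⊤ := by
  have hext (c : Δ) (i : I) := l.finiteOver_range_panelExtensionHom hC hM (hgen i) hΦ c
  have := l.finite_orbitRel_quotient hC hM horb
  have := hC.nonempty
  refine finiteOver_top_of_reflTransGen (r := fun c d => ∃ i, C.adj i c d)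
    (K := fun c => ⨆ i, (l.panelExtensionHom hC hM c i).range)
    (D := fun c => ⋃ i, Set.range fun q : MulAction.orbitRel.Quotient (F i) (X i) =>
      l.move c i q.out)
    (fun g c d => Exists.imp fun i => (adj_smul_iff g).2) hC.reflTransGen_adj
    (l.finiteOver_stabilizer hC hM hext hΦ (.of_le le_rfl)) (fun c => .iSup (hext c))
    (fun c => Set.finite_iUnion fun i => Set.finite_range _) ?_
  rintro c d ⟨i, hcd⟩
  obtain ⟨f, hf⟩ := l.panelExtensionHom_smul_mem_range hC hM hcd
  exact ⟨_, Subgroup.mem_iSup_of_mem i ⟨f, rfl⟩, Set.mem_iUnion.2 ⟨i, hf⟩⟩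

end LegalColouring

theorem mainTheorem4 {I : Type*} [Finite I] (M : CoxeterMatrix I) (hM : M.IsRightAngled)
    {Δ : Type*} (C : ChamberSystem I Δ) (hC : C.IsBuilding M)
    {X : I → Type*} (l : LegalColouring C X) (F : ∀ i, Subgroup (Equiv.Perm (X i)))
    (hclosed : IsClosed (l.universalGroup F : Set C.aut))
    (hlc : LocallyCompactSpace (l.universalGroup F))
    (hgen : ∀ i, IsCompactlyGeneratedGroup (F i))
    (horb : ∀ i, Finite (MulAction.orbitRel.Quotient (F i) (X i))) :
    IsCompactlyGeneratedGroup (l.universalGroup F) := by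
  have hinducing : Topology.IsInducing (MulAction.toPermHom (l.universalGroup F) Δ) :=
    Topology.IsInducing.subtypeVal.comp Topology.IsInducing.subtypeVal
  exact isCompactlyGeneratedGroup_of_finiteOver_fixingSubgroup hinducing fun _ hΦ =>
    l.finiteOver_fixingSubgroup_top hC hM hgen horb hΦ
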